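/- Let $T$ be a countably infinite discrete group. A flow is a compact metric space on which $T$ acts by homeomorphisms. Let $\beta T$ be the semigroup of ultrafilters on $T$ (the universal point transitive flow), acting on every flow by $px=\lim_{t\to p}tx$. Then $\beta T$ has minimal left ideals (as flows, these are the universal minimal flow of $T$); let $M$ be one of them. Let $\pi:X\to Y$ be an extension (continuous equivariant surjection) of minimal flows. A pair $(x,x')$ is proximal if $\inf_{t\in T}d(tx,tx')=0$, and an extension is proximal if any two points in the same fibre form a proximal pair. A set $A\subseteq X$ is almost periodic if the point $(a)_{a\in A}$ of the product flow $X^{A}$ is a minimal point (its orbit closure is a minimal flow). Assume that * $\pi$ is regular: for all $x_1,x_2\in X$ with $\pi(x_1)=\pi(x_2)$ there is a homeomorphism $\chi:X\to X$ commuting with $T$, with $\pi\circ\chi=\pi$, such that $(\chi(x_1),x_2)$ is proximal; * $\pi$ is almost proximal: for each $y\in Y$ there is $N\in\mathbb N$ such that every almost periodic subset of $\pi^{-1}(y)$ has at most $N$ elements. **Theorem.** For every $y_0\in Y$ there is an idempotent $u\in M$ with $uy_0=y_0$, and for every such $u$ the following holds. The sets $p\,u\,\pi^{-1}(y_0)=\{p(ux):\pi(x)=y_0\}$,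 $p\in M$, form a partition of $X$. The set $$Y^\#=\{p\,u\,\pi^{-1}(y_0): p\in M\}\subseteq 2^X$$ is compact and $T$-invariant in the hyperspace $2^X$ of nonempty closed subsets of $X$ with the Hausdorff metric and the action $tA=\{ta:a\in A\}$, and $(Y^\#,T)$ is a minimal flow. The map $\pi^\#:X\to Y^\#$ sending $x$ to the member of the partition containing it, and the map $\tau^\#:Y^\#\to Y$, $p\,u\,\pi^{-1}(y_0)\mapsto py_0$, are well-defined extensions of flows with $$\pi=\tau^\#\circ\pi^\#.$$ Here $\pi^\#$ is finite to one (all fibres are finite) and equicontinuous (for every $\varepsilon>0$ there is $\delta>0$ such that $\pi^\#(x_1)=\pi^\#(x_2)$ and $d(x_1,x_2)<\delta$ imply $d(tx_1,tx_2)<\varepsilon$ for all $t\in T$), and $\tau^\#$ is proximal. Moreover, $\pi$ is almost finite to one (some fibre of $\pi$ is finite) if and only if $\tau^\#$ is almost one to one (there is a dense $G_\delta$ set $Z\subseteq Y^\#$ such that $(\tau^\#)^{-1}(\tau^\#(z))=\{z\}$ for all $z\in Z$). -/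

import Mathlib

open Set Filter Topology TopologicalSpace

attribute [local instance] Ultrafilter.mul

section Flows

variable (T : Type*) [Group T]

/-- A factor map (extension): a continuous equivariant surjection. -/
structure IsFactorMap {X Y : Type*} [TopologicalSpace X] [TopologicalSpace Y]
    [MulAction T X] [MulAction T Y] (π : X → Y) : Prop where
  continuous : Continuous π
  surjective : Function.Surjective π
  map_smul : ∀ (t : T) (x : X), π (t • x) = t • π x

/-- A minimal (almost periodic) point: its orbit closure has no proper nonempty closed
invariant subset. -/
def IsMinimalPoint {X : Type*} [TopologicalSpace X] [MulAction T X] (x : X) : Prop :=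
  ∀ S : Set X, S ⊆ closure (MulAction.orbit T x) → IsClosed S → S.Nonempty →
    (∀ (t : T), ∀ s ∈ S, t • s ∈ S) → S = closure (MulAction.orbit T x)

/-- `A` is an almost periodic set: the point of `X ^ A` that enumerates `A` is a minimal point of
the product flow. -/
def IsAlmostPeriodicSet {X : Type*} [TopologicalSpace X] [MulAction T X] (A : Set X) : Prop :=
  IsMinimalPoint T (fun a : A => (a : X))

/-- The proximal relation. -/
def IsProximalPair {X : Type*} [MetricSpace X] [MulAction T X] (x y : X) : Prop :=
  ⨅ t : T, dist (t • x) (t • y) = 0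

def IsProximalExtension {X Y : Type*} [MetricSpace X] [MulAction T X] (π : X → Y) : Prop :=
  ∀ x₁ x₂ : X, π x₁ = π x₂ → IsProximalPair T x₁ x₂

def IsAlmostProximalExtension {X Y : Type*} [TopologicalSpace X] [MulAction T X]
    (π : X → Y) : Prop :=
  ∀ y : Y, ∃ N : ℕ, ∀ A : Set X, A ⊆ π ⁻¹' {y} → IsAlmostPeriodicSet T A → A.encard ≤ N

def IsEquicontinuousExtension {X Y : Type*} [MetricSpace X] [MulAction T X] (π : X → Y) : Prop :=
  ∀ ε > 0, ∃ δ > 0, ∀ x₁ x₂ : X, π x₁ = π x₂ → dist x₁ x₂ < δ →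
    ∀ t : T, dist (t • x₁) (t • x₂) < ε

/-- Regular extension: any two points of a fibre become proximal after applying to the first one
an automorphism of the flow which preserves all fibres. -/
def IsRegularExtension {X Y : Type*} [MetricSpace X] [MulAction T X] (π : X → Y) : Prop :=
  ∀ x₁ x₂ : X, π x₁ = π x₂ → ∃ χ : X ≃ₜ X, (∀ (t : T) (x : X), χ (t • x) = t • χ x) ∧
    (∀ x, π (χ x) = π x) ∧ IsProximalPair T (χ x₁) x₂

end Flows

def IsFiniteToOne {X Y : Type*} (π : X → Y) : Prop :=
  ∀ y : Y, (π ⁻¹' {y}).Finite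

def IsAlmostFiniteToOne {X Y : Type*} (π : X → Y) : Prop :=
  ∃ y : Y, (π ⁻¹' {y}).Finite

def IsAlmostOneToOne {X Y : Type*} [TopologicalSpace X] (π : X → Y) : Prop :=
  ∃ X₀ : Set X, IsGδ X₀ ∧ Dense X₀ ∧ ∀ x ∈ X₀, π ⁻¹' {π x} = {x}

/-- The hyperspace flow: `T` acts on the nonempty compact subsets of `X` (with the Hausdorff
metric) by `t • A = {t • a | a ∈ A}`. -/
instance hyperspaceMulAction {T X : Type*} [Group T] [TopologicalSpace X] [MulAction T X]
    [ContinuousConstSMul T X] : MulAction T (NonemptyCompacts X) where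
  smul t A := A.map (fun x => t • x) (continuous_const_smul t)
  one_smul A := by
    apply SetLike.coe_injective
    change (fun x => (1 : T) • x) '' (A : Set X) = A
    simp
  mul_smul s t A := by
    apply SetLike.coe_injective
    change (fun x => (s * t) • x) '' (A : Set X) =
      (fun x => s • x) '' ((fun x => t • x) '' (A : Set X))
    simp [Set.image_image, mul_smul]

theorem hyperspace_coe_smul {T X : Type*} [Group T] [TopologicalSpace X] [MulAction T X]
    [ContinuousConstSMul T X] (t : T) (A : NonemptyCompacts X) :
    ((t • A : NonemptyCompacts X) : Set X) = (fun x => t • x) '' (A : Set X) := rfl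

instance hyperspaceContinuousConstSMul {T X : Type*} [Group T] [TopologicalSpace X]
    [MulAction T X] [ContinuousConstSMul T X] : ContinuousConstSMul T (NonemptyCompacts X) where
  continuous_const_smul t := (continuous_const_smul t).nonemptyCompacts_map

/-- For discrete `T`, the universal point transitive flow `S_T` is the semigroup `βT` of
ultrafilters on `T`; it acts on a compact Hausdorff flow by `p • x = lim_{t → p} t • x`. -/
noncomputable def ultraAct {T X : Type*} [Group T] [TopologicalSpace X] [MulAction T X]
    (p : Ultrafilter T) (x : X) : X :=
  Ultrafilter.extend (fun t : T => t • x) p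

/-- A minimal left ideal of `βT`; as a flow it is (isomorphic to) the universal minimal flow
of `T`. -/
structure MinimalLeftIdeal (T : Type*) [Group T] where
  carrier : Set (Ultrafilter T)
  nonempty : carrier.Nonempty
  mul_mem : ∀ (p q : Ultrafilter T), q ∈ carrier → p * q ∈ carrier
  minimal : ∀ I : Set (Ultrafilter T), I ⊆ carrier → I.Nonempty →
    (∀ (p q : Ultrafilter T), q ∈ I → p * q ∈ I) → I = carrier

theorem ultraAct_pure_mul {T X : Type*} [Group T] [TopologicalSpace X] [CompactSpace X]
    [T2Space X] [MulAction T X] [ContinuousConstSMul T X] (t : T) (p : Ultrafilter T) (x : X) :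
    ultraAct (pure t * p) x = t • ultraAct p x := by
  refine ultrafilter_extend_eq_iff.2 ?_
  have h : Tendsto (fun s : T => s • x) (p : Filter T) (𝓝 (ultraAct p x)) :=
    ultrafilter_extend_eq_iff.1 rfl
  have h2 := ((continuous_const_smul t).tendsto (ultraAct p x)).comp h
  intro s hs
  have h3 : ∀ᶠ m in (p : Filter T), t • m • x ∈ s := h2 hs
  change ∀ᶠ m in ((pure t * p : Ultrafilter T) : Filter T), m • x ∈ s
  rw [Ultrafilter.eventually_mul]
  change ∀ᶠ m' in (p : Filter T), (t * m') • x ∈ s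
  simpa [mul_smul] using h3

section Sharp

variable {T X Y : Type*} [Group T] [MulAction T X]

/-- The translate `p u π⁻¹(y₀) = {p (u x) | π x = y₀}`. -/
def fiberTranslate [TopologicalSpace X] (π : X → Y) (y₀ : Y) (u p : Ultrafilter T) : Set X :=
  ultraAct p '' (ultraAct u '' (π ⁻¹' {y₀}))

/-- The set `{p u π⁻¹(y₀) | p ∈ M}`, as a subset of the hyperspace of `X`. -/
def SharpSpace [TopologicalSpace X] (M : MinimalLeftIdeal T) (π : X → Y) (y₀ : Y)
    (u : Ultrafilter T) : Set (NonemptyCompacts X) :=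
  {A | ∃ p ∈ M.carrier, (A : Set X) = fiberTranslate π y₀ u p}

variable [MetricSpace X] [CompactSpace X] [ContinuousConstSMul T X]

theorem SharpSpace.smul_mem (M : MinimalLeftIdeal T) (π : X → Y) (y₀ : Y)
    (u : Ultrafilter T) (t : T) {A : NonemptyCompacts X} (hA : A ∈ SharpSpace M π y₀ u) :
    t • A ∈ SharpSpace M π y₀ u := by
  obtain ⟨p, hp, h⟩ := hA
  refine ⟨pure t * p, M.mul_mem _ _ hp, ?_⟩
  rw [hyperspace_coe_smul, h, fiberTranslate, fiberTranslate, Set.image_image (fun x => t • x)]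
  exact Set.image_congr fun x _ => (ultraAct_pure_mul t p x).symm

/-- The restriction of the hyperspace flow to `SharpSpace`. -/
instance SharpSpace.mulAction (M : MinimalLeftIdeal T) (π : X → Y) (y₀ : Y)
    (u : Ultrafilter T) : MulAction T (SharpSpace M π y₀ u) where
  smul t A := ⟨t • A.1, SharpSpace.smul_mem M π y₀ u t A.2⟩
  one_smul A := Subtype.ext (one_smul T A.1)
  mul_smul s t A := Subtype.ext (mul_smul s t A.1)

instance SharpSpace.continuousConstSMul (M : MinimalLeftIdeal T) (π : X → Y) (y₀ : Y)
    (u : Ultrafilter T) : ContinuousConstSMul T (SharpSpace M π y₀ u) where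
  continuous_const_smul t :=
    ((continuous_const_smul t).comp continuous_subtype_val).subtype_mk _

end Sharp

/-! Let `F = u π⁻¹(y₀)`, the set of `u`-fixed points over `y₀`. Elements of `M` are injective on
`u`-fixed points, because each has a left multiple equal to `u` (`ultraAct_injOn`); hence proximal
`u`-fixed points coincide (`eq_of_isProximalPair`). Being pointwise fixed by `u`, `F` is an almost
periodic set, so almost proximality makes it finite. Regularity supplies automorphisms over `Y` that
act transitively on `F`; they commute with `βT`, so translates `pF` and `qF` that meet are equal
(`fiberTranslate_subset_of_mem`). This gives the partition.

Since `F` is finite, `p ↦ pF` is continuous for the Hausdorff metric. Thus the sharp space is a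
quotient of `M`, and its compactness, its minimality and the continuity of both factors are read off
on `M`. Compactness of `M` also separates distinct points of a translate by a uniform distance,
which yields equicontinuity. Points `pF`, `qF` over the same point of `Y` are carried to `F` by a
single ultrafilter, so `τ#` is proximal. Finally, a finite fibre of `τ#` can be shrunk as a whole,
and Baire category gives almost one to one. -/

/-! ### The action of `βT` on compact flows -/

section UltrafilterAction

variable {T X Y : Type*} [Group T]

theorem ultrafilter_mul_assoc (p q r : Ultrafilter T) : p * q * r = p * (q * r) :=
  Ultrafilter.semigroup.mul_assoc p q r

variable [TopologicalSpace X] [CompactSpace X] [T2Space X] [MulAction T X]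
  [TopologicalSpace Y] [CompactSpace Y] [T2Space Y] [MulAction T Y]

theorem continuous_ultraAct (x : X) : Continuous fun p : Ultrafilter T => ultraAct p x :=
  continuous_ultrafilter_extend _

theorem tendsto_ultraAct (p : Ultrafilter T) (x : X) :
    Tendsto (fun t : T => t • x) p (𝓝 (ultraAct p x)) :=
  ultrafilter_extend_eq_iff.1 rfl

theorem ultraAct_pure {X : Type*} [TopologicalSpace X] [T2Space X] [MulAction T X]
    (t : T) (x : X) : ultraAct (pure t : Ultrafilter T) x = t • x :=
  congrFun (ultrafilter_extend_extends fun s : T => s • x) t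

/-- Principal ultrafilters are dense in `βT`, so identities for the action need only be checked on
`T`. -/
theorem eq_ultraAct_of_continuous {f : Ultrafilter T → X} (hf : Continuous f) {x : X}
    (h : ∀ t : T, f (pure t) = t • x) (p : Ultrafilter T) : f p = ultraAct p x := by
  refine congrFun (denseRange_pure.equalizer hf (continuous_ultraAct x) ?_) p
  funext t
  simp [h, ultraAct_pure]

theorem map_ultraAct {f : X → Y} (hf : Continuous f) (h : ∀ (t : T) (x : X), f (t • x) = t • f x)
    (p : Ultrafilter T) (x : X) : f (ultraAct p x) = ultraAct p (f x) :=
  eq_ultraAct_of_continuous (f := fun q => f (ultraAct q x)) (hf.comp (continuous_ultraAct x))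
    (fun t => by rw [ultraAct_pure, h]) p

theorem closure_orbit_eq_range_ultraAct (x : X) :
    closure (MulAction.orbit T x) = range fun p : Ultrafilter T => ultraAct p x := by
  apply Subset.antisymm
  · refine closure_minimal ?_ (isCompact_range (continuous_ultraAct x)).isClosed
    rintro _ ⟨t, rfl⟩
    exact ⟨pure t, ultraAct_pure t x⟩
  · rintro _ ⟨p, rfl⟩
    exact mem_closure_of_tendsto (tendsto_ultraAct p x)
      (Eventually.of_forall fun t => MulAction.mem_orbit x t)

theorem ultraAct_mem {S : Set X} (hS : IsClosed S) (hinv : ∀ (t : T), ∀ s ∈ S, t • s ∈ S)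
    (p : Ultrafilter T) {x : X} (hx : x ∈ S) : ultraAct p x ∈ S :=
  hS.mem_of_tendsto (tendsto_ultraAct p x) (Eventually.of_forall fun t => hinv t x hx)

theorem ultraAct_mul [ContinuousConstSMul T X] (p q : Ultrafilter T) (x : X) :
    ultraAct (p * q) x = ultraAct p (ultraAct q x) :=
  eq_ultraAct_of_continuous (f := fun r => ultraAct (r * q) x)
    ((continuous_ultraAct x).comp (Ultrafilter.continuous_mul_left q))
    (fun t => ultraAct_pure_mul t q x) p

theorem ultraAct_pi {A : Type*} (p : Ultrafilter T) (z : A → X) (a : A) :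
    ultraAct p z a = ultraAct p (z a) :=
  map_ultraAct (f := fun w : A → X => w a) (continuous_apply a) (fun _ _ => rfl) p z

end UltrafilterAction

/-! ### Proximality as collapse by an ultrafilter -/

theorem IsProximalPair.exists_ultraAct_eq {T X : Type*} [Group T] [MetricSpace X] [CompactSpace X]
    [MulAction T X] {x y : X} (h : IsProximalPair T x y) :
    ∃ p : Ultrafilter T, ultraAct p x = ultraAct p y := by
  have hc : Continuous fun p : Ultrafilter T => dist (ultraAct p x) (ultraAct p y) :=
    (continuous_ultraAct x).dist (continuous_ultraAct y)
  obtain ⟨p, -, hp⟩ := isCompact_univ.exists_isMinOn univ_nonempty hc.continuousOn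
  refine ⟨p, dist_le_zero.1 ?_⟩
  rw [← show (⨅ t : T, dist (t • x) (t • y)) = 0 from h]
  refine le_ciInf fun t => ?_
  simpa [ultraAct_pure] using hp (mem_univ (pure t))

theorem isProximalPair_of_ultraAct_eq {T X : Type*} [Group T] [MetricSpace X] [CompactSpace X]
    [MulAction T X] {x y : X} {p : Ultrafilter T} (h : ultraAct p x = ultraAct p y) :
    IsProximalPair T x y := by
  have hb : BddBelow (range fun t : T => dist (t • x) (t • y)) :=
    ⟨0, by rintro _ ⟨t, rfl⟩; exact dist_nonneg⟩
  have ht : Tendsto (fun t : T => dist (t • x) (t • y)) p (𝓝 0) := by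
    have := (tendsto_ultraAct p x).dist (tendsto_ultraAct p y)
    rwa [h, dist_self] at this
  exact le_antisymm (ge_of_tendsto ht (Eventually.of_forall fun t => ciInf_le hb t))
    (le_ciInf fun _ => dist_nonneg)

/-! ### Minimal left ideals and their idempotents -/

/-- Zorn gives a minimal closed left ideal. It is minimal among all left ideals, since any left
ideal containing `q` contains the closed left ideal `βT q`. -/
theorem nonempty_minimalLeftIdeal (T : Type*) [Group T] : Nonempty (MinimalLeftIdeal T) := by
  let S : Set (Set (Ultrafilter T)) :=
    {I | IsClosed I ∧ I.Nonempty ∧ ∀ p q : Ultrafilter T, q ∈ I → p * q ∈ I}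
  obtain ⟨L, hL⟩ : ∃ L, Minimal (· ∈ S) L := by
    refine zorn_superset _ fun c hcs hc => ?_
    refine ⟨⋂₀ c, ⟨isClosed_sInter fun t ht => (hcs ht).1, ?_, fun p q hq s hs =>
      (hcs hs).2.2 p q (hq s hs)⟩, fun s hs => sInter_subset_of_mem hs⟩
    obtain rfl | hne := c.eq_empty_or_nonempty
    · rw [sInter_empty]
      exact univ_nonempty
    · have : Nonempty c := hne.coe_sort
      rw [sInter_eq_iInter]
      exact IsCompact.nonempty_iInter_of_directed_nonempty_isCompact_isClosed _
        (DirectedOn.directed_val (IsChain.directedOn hc.symm)) (fun i => (hcs i.2).2.1)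
        (fun i => (hcs i.2).1.isCompact) (fun i => (hcs i.2).1)
  refine ⟨⟨L, hL.prop.2.1, hL.prop.2.2, fun I hIL ⟨q, hq⟩ hI => Subset.antisymm hIL ?_⟩⟩
  have hsub : range (fun p : Ultrafilter T => p * q) ⊆ I := by
    rintro _ ⟨p, rfl⟩
    exact hI p q hq
  refine Subset.trans (hL.2 ⟨?_, range_nonempty _, ?_⟩ (hsub.trans hIL)) hsub
  · exact (isCompact_range (Ultrafilter.continuous_mul_left q)).isClosed
  · rintro p _ ⟨r, rfl⟩
    exact ⟨p * r, ultrafilter_mul_assoc p r q⟩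

namespace MinimalLeftIdeal

variable {T X Y : Type*} [Group T] (M : MinimalLeftIdeal T)

theorem range_mul_right {q : Ultrafilter T} (hq : q ∈ M.carrier) :
    range (fun p : Ultrafilter T => p * q) = M.carrier := by
  refine M.minimal _ ?_ (range_nonempty _) ?_
  · rintro _ ⟨p, rfl⟩
    exact M.mul_mem p q hq
  · rintro p _ ⟨r, rfl⟩
    exact ⟨p * r, ultrafilter_mul_assoc p r q⟩

theorem exists_mul_eq {q r : Ultrafilter T} (hq : q ∈ M.carrier) (hr : r ∈ M.carrier) :
    ∃ p, p * q = r := by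
  rwa [← M.range_mul_right hq] at hr

theorem isClosed_carrier : IsClosed M.carrier := by
  obtain ⟨q, hq⟩ := M.nonempty
  rw [← M.range_mul_right hq]
  exact (isCompact_range (Ultrafilter.continuous_mul_left q)).isClosed

theorem mul_idempotent {u p : Ultrafilter T} (hu : u ∈ M.carrier) (huu : u * u = u)
    (hp : p ∈ M.carrier) : p * u = p := by
  obtain ⟨r, rfl⟩ := M.exists_mul_eq hu hp
  rw [ultrafilter_mul_assoc, huu]

section

variable [TopologicalSpace X] [CompactSpace X] [T2Space X] [MulAction T X]
  [ContinuousConstSMul T X]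

/-- Some `q` satisfies `q * p = u`, and it inverts `p` on the points fixed by `u`. -/
theorem ultraAct_injOn {u p : Ultrafilter T} (hu : u ∈ M.carrier) (hp : p ∈ M.carrier) :
    InjOn (ultraAct p : X → X) {x | ultraAct u x = x} := by
  obtain ⟨q, hq⟩ := M.exists_mul_eq hp hu
  intro x hx y hy h
  rw [← show ultraAct u x = x from hx, ← show ultraAct u y = y from hy, ← hq, ultraAct_mul,
    ultraAct_mul, h]

theorem isMinimalPoint {u : Ultrafilter T} (hu : u ∈ M.carrier) {x : X} (hx : ultraAct u x = x) :
    IsMinimalPoint T x := by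
  intro S hS hcl ⟨s, hs⟩ hinv
  refine Subset.antisymm hS (closure_minimal ?_ hcl)
  obtain ⟨p, rfl⟩ := closure_orbit_eq_range_ultraAct (T := T) x ▸ hS hs
  obtain ⟨q, hq⟩ := M.exists_mul_eq (M.mul_mem p u hu) hu
  have hxS : x ∈ S := by
    rw [← hx, ← hq, ultraAct_mul, ultraAct_mul, hx]
    exact ultraAct_mem hcl hinv q hs
  rintro _ ⟨t, rfl⟩
  exact hinv t x hxS

theorem isAlmostPeriodicSet {u : Ultrafilter T} (hu : u ∈ M.carrier) {A : Set X}
    (hA : ∀ x ∈ A, ultraAct u x = x) : IsAlmostPeriodicSet T A :=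
  M.isMinimalPoint hu (funext fun a => by rw [ultraAct_pi, hA a a.2])

theorem exists_ultraAct_eq [MulAction.IsMinimal T X] (x y : X) :
    ∃ p ∈ M.carrier, ultraAct p x = y := by
  obtain ⟨q, hq⟩ := M.nonempty
  have h := (MulAction.dense_orbit T (ultraAct q x)).closure_eq
  rw [closure_orbit_eq_range_ultraAct] at h
  obtain ⟨p, hp⟩ := h.symm ▸ mem_univ y
  exact ⟨p * q, M.mul_mem p q hq, by rw [ultraAct_mul]; exact hp⟩

/-- The elements of `M` fixing `x` form a nonempty compact subsemigroup, to which the Ellis–Numakura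
lemma applies. -/
theorem exists_idempotent [MulAction.IsMinimal T X] (x : X) :
    ∃ u ∈ M.carrier, u * u = u ∧ ultraAct u x = x := by
  let : Semigroup (Ultrafilter T) := Ultrafilter.semigroup
  obtain ⟨u, ⟨hu, hux⟩, huu⟩ := exists_idempotent_in_compact_subsemigroup
    (M := Ultrafilter T) Ultrafilter.continuous_mul_left
    (M.carrier ∩ {p | ultraAct p x = x}) (M.exists_ultraAct_eq x x)
    ((M.isClosed_carrier.inter (isClosed_eq (continuous_ultraAct x) continuous_const)).isCompact)
    (fun p hp q hq => ⟨M.mul_mem p q hq.1, by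
      change ultraAct (p * q) x = x
      rw [ultraAct_mul, hq.2, hp.2]⟩)
  exact ⟨u, hu, huu, hux⟩

end

theorem eq_of_isProximalPair [MetricSpace X] [CompactSpace X] [MulAction T X]
    [ContinuousConstSMul T X] {u : Ultrafilter T} (hu : u ∈ M.carrier) {x y : X}
    (hx : ultraAct u x = x) (hy : ultraAct u y = y) (h : IsProximalPair T x y) : x = y := by
  obtain ⟨p, hp⟩ := h.exists_ultraAct_eq
  refine M.ultraAct_injOn hu (M.mul_mem p u hu) hx hy ?_
  -- The collapsing `p` need not lie in `M`, but `p * u` does and acts on `x`, `y` in the same way.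
  rw [ultraAct_mul, ultraAct_mul, hx, hy, hp]

end MinimalLeftIdeal

/-! ### Proximal extensions with a finite fibre -/

/-- A proximal extension of a minimal flow with a finite fibre is almost one to one. -/
theorem IsProximalExtension.isAlmostOneToOne {T Z Y : Type*} [Group T]
    [MetricSpace Z] [CompactSpace Z] [MulAction T Z] [ContinuousConstSMul T Z]
    [MulAction.IsMinimal T Z] [MetricSpace Y] [CompactSpace Y] [MulAction T Y]
    [ContinuousConstSMul T Y] [MulAction.IsMinimal T Y] {τ : Z → Y} (hτ : IsFactorMap T τ)
    (hprox : IsProximalExtension T τ) (hfin : IsAlmostFiniteToOne τ) : IsAlmostOneToOne τ := by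
  obtain ⟨M⟩ := nonempty_minimalLeftIdeal T
  obtain ⟨y, hy⟩ := hfin
  obtain ⟨z, rfl⟩ := hτ.surjective y
  obtain ⟨v, hv, hvv, hvy⟩ := M.exists_idempotent (τ z)
  have hcollapse : ∀ p ∈ M.carrier, ∀ z', τ z' = τ z → ultraAct p z' = ultraAct p z := by
    intro p hp z' hz'
    rw [← M.mul_idempotent hv hvv hp, ultraAct_mul, ultraAct_mul]
    congr 1
    refine M.eq_of_isProximalPair hv ?_ ?_ (hprox _ _ ?_)
    · rw [← ultraAct_mul, hvv]
    · rw [← ultraAct_mul, hvv]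
    · rw [map_ultraAct hτ.continuous hτ.map_smul, map_ultraAct hτ.continuous hτ.map_smul, hz']
  -- Baire category: a point of every `V n` is alone in its fibre.
  let V : ℕ → Set Z := fun n => {w | ∀ w', τ w' = τ w → dist w w' < 1 / ((n : ℝ) + 1)}
  have hVo : ∀ n, IsOpen (V n) := by
    intro n
    have hK : IsClosed {w : Z × Z | τ w.2 = τ w.1 ∧ 1 / ((n : ℝ) + 1) ≤ dist w.1 w.2} :=
      (isClosed_eq (hτ.continuous.comp continuous_snd) (hτ.continuous.comp continuous_fst)).inter
        (isClosed_le continuous_const continuous_dist)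
    have hV : V n = (Prod.fst '' {w : Z × Z | τ w.2 = τ w.1 ∧
        1 / ((n : ℝ) + 1) ≤ dist w.1 w.2})ᶜ := by
      ext w
      simp only [V, mem_ofPred_eq, mem_compl_iff, mem_image, Prod.exists, not_exists, not_and]
      constructor
      · rintro h a b ⟨hab, hd⟩ rfl
        exact absurd (h b hab) (not_lt.2 hd)
      · intro h w' hw'
        by_contra hd
        exact h w w' ⟨hw', not_lt.1 hd⟩ rfl
    rw [hV]
    exact (hK.isCompact.image continuous_fst).isClosed.isOpen_compl
  have hVd : ∀ n, Dense (V n) := by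
    intro n w
    obtain ⟨p, hp, rfl⟩ := M.exists_ultraAct_eq z w
    refine mem_closure_of_tendsto (tendsto_ultraAct p z) ?_
    have h : ∀ z' ∈ τ ⁻¹' {τ z}, ∀ᶠ t : T in p, dist (t • z) (t • z') < 1 / ((n : ℝ) + 1) := by
      intro z' hz'
      have := (tendsto_ultraAct p z).dist (tendsto_ultraAct p z')
      rw [hcollapse p hp z' hz', dist_self] at this
      exact this.eventually_lt_const (by positivity)
    -- Finiteness lets one `t` serve the whole fibre of `z`; its translate by `t` is the fibre of `t
    -- • z`.
    filter_upwards [(eventually_all_finite hy).2 h] with t ht w' hw'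
    have := ht (t⁻¹ • w') (by
      change τ (t⁻¹ • w') = τ z
      rw [hτ.map_smul, hw', hτ.map_smul, inv_smul_smul])
    rwa [smul_inv_smul] at this
  refine ⟨⋂ n, V n, IsGδ.iInter_of_isOpen hVo, dense_iInter_of_isOpen hVo hVd, fun w hw => ?_⟩
  refine Subset.antisymm (fun w' hw' => ?_) (by rintro _ rfl; rfl)
  have h0 : dist w w' ≤ 0 :=
    ge_of_tendsto' tendsto_one_div_add_atTop_nhds_zero_nat fun n => (mem_iInter.1 hw n w' hw').le
  exact (dist_le_zero.1 h0).symm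

/-! ### Translates of a finite set in the hyperspace -/

section FiniteTranslates

variable {T X : Type*} [Group T] [MetricSpace X] [MulAction T X]

/-- The translate `p F` of a finite nonempty set `F`, as a point of the hyperspace. -/
noncomputable def finiteTranslate {F : Set X} (hF : F.Finite) (hne : F.Nonempty)
    (p : Ultrafilter T) : NonemptyCompacts X :=
  ⟨⟨ultraAct p '' F, (hF.image _).isCompact⟩, hne.image _⟩

theorem coe_finiteTranslate {F : Set X} (hF : F.Finite) (hne : F.Nonempty) (p : Ultrafilter T) :
    (finiteTranslate hF hne p : Set X) = ultraAct p '' F := rfl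

variable [CompactSpace X]

theorem continuous_finiteTranslate {F : Set X} (hF : F.Finite) (hne : F.Nonempty) :
    Continuous (finiteTranslate (T := T) hF hne) := by
  refine continuous_iff_continuousAt.2 fun p => Metric.tendsto_nhds.2 fun ε hε => ?_
  have h : ∀ x ∈ F, ∀ᶠ q in 𝓝 p, dist (ultraAct q x) (ultraAct p x) < ε / 2 := fun x _ =>
    Metric.tendsto_nhds.1 ((continuous_ultraAct x).tendsto p) _ (half_pos hε)
  filter_upwards [(eventually_all_finite hF).2 h] with q hq
  refine lt_of_le_of_lt ?_ (half_lt_self hε)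
  rw [Metric.NonemptyCompacts.dist_eq]
  refine Metric.hausdorffDist_le_of_mem_dist (half_pos hε).le ?_ ?_
  · rintro _ ⟨x, hx, rfl⟩
    exact ⟨_, mem_image_of_mem _ hx, (hq x hx).le⟩
  · rintro _ ⟨x, hx, rfl⟩
    exact ⟨_, mem_image_of_mem _ hx, by rw [dist_comm]; exact (hq x hx).le⟩

/-- Distinct points of the translates `p F`, `p ∈ M`, are uniformly separated. -/
theorem exists_separation_of_translates [ContinuousConstSMul T X] (M : MinimalLeftIdeal T)
    {u : Ultrafilter T} (hu : u ∈ M.carrier) {F : Set X} (hF : F.Finite)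
    (hfix : ∀ x ∈ F, ultraAct u x = x) :
    ∃ δ > 0, ∀ p ∈ M.carrier, ∀ a ∈ F, ∀ b ∈ F,
      dist (ultraAct p a) (ultraAct p b) < δ → a = b := by
  have hpair : ∀ w ∈ F ×ˢ F, ∃ δ > 0, ∀ p ∈ M.carrier,
      dist (ultraAct p w.1) (ultraAct p w.2) < δ → w.1 = w.2 := by
    rintro ⟨a, b⟩ ⟨ha, hb⟩
    have hc : Continuous fun p : Ultrafilter T => dist (ultraAct p a) (ultraAct p b) :=
      (continuous_ultraAct a).dist (continuous_ultraAct b)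
    -- For `a ≠ b` the minimum over the compact `M` is positive by injectivity, and serves as `δ`.
    obtain ⟨p, hp, hmin⟩ := M.isClosed_carrier.isCompact.exists_isMinOn M.nonempty hc.continuousOn
    by_cases hab : a = b
    · exact ⟨1, one_pos, fun _ _ _ => hab⟩
    · refine ⟨dist (ultraAct p a) (ultraAct p b), dist_pos.2 fun h => hab ?_, fun q hq h => ?_⟩
      · exact M.ultraAct_injOn hu hp (hfix a ha) (hfix b hb) h
      · exact absurd h (not_lt.2 (hmin hq))
  have hev : ∀ w ∈ F ×ˢ F, ∀ᶠ δ : ℝ in 𝓝[>] 0, ∀ p ∈ M.carrier,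
      dist (ultraAct p w.1) (ultraAct p w.2) < δ → w.1 = w.2 := by
    intro w hw
    obtain ⟨δ, hδ, h⟩ := hpair w hw
    filter_upwards [Ioo_mem_nhdsGT hδ] with δ' hδ' p hp hd
    exact h p hp (hd.trans hδ'.2)
  obtain ⟨δ, h, hδ⟩ :=
    (((eventually_all_finite (hF.prod hF)).2 hev).and self_mem_nhdsWithin).exists
  exact ⟨δ, hδ, fun p hp a ha b hb => h (a, b) ⟨ha, hb⟩ p hp⟩

end FiniteTranslates

/-! ### The sharp space and the partition -/

section Sharp

variable {T X Y : Type*} [Group T] [MetricSpace X] [MulAction T X] {π : X → Y}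
  {M : MinimalLeftIdeal T} {y₀ : Y} {u : Ultrafilter T}

theorem fiberTranslate_nonempty (hπ : Function.Surjective π) (p : Ultrafilter T) :
    (fiberTranslate π y₀ u p).Nonempty := by
  obtain ⟨x, hx⟩ := hπ y₀
  exact ⟨_, _, ⟨x, hx, rfl⟩, rfl⟩

/-- A parametrisation of the sharp space by the minimal left ideal. -/
noncomputable def SharpSpace.mk (hne : (π ⁻¹' {y₀}).Nonempty)
    (hF : (ultraAct u '' (π ⁻¹' {y₀})).Finite) (p : M.carrier) : SharpSpace M π y₀ u :=
  ⟨finiteTranslate hF (hne.image _) p.1, p.1, p.2, rfl⟩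

section

variable (hne : (π ⁻¹' {y₀}).Nonempty) (hF : (ultraAct u '' (π ⁻¹' {y₀})).Finite)

theorem SharpSpace.coe_mk (p : M.carrier) :
    ((SharpSpace.mk hne hF p : NonemptyCompacts X) : Set X) = fiberTranslate π y₀ u p := rfl

theorem SharpSpace.eq_mk {A : SharpSpace M π y₀ u} {p : M.carrier}
    (h : ((A : NonemptyCompacts X) : Set X) = fiberTranslate π y₀ u p) :
    A = SharpSpace.mk hne hF p :=
  Subtype.ext (SetLike.coe_injective h)

theorem SharpSpace.surjective_mk : Function.Surjective (SharpSpace.mk (M := M) hne hF) := by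
  rintro ⟨A, p, hp, h⟩
  exact ⟨⟨p, hp⟩, (SharpSpace.eq_mk (A := ⟨A, p, hp, h⟩) (p := ⟨p, hp⟩) hne hF h).symm⟩

variable [CompactSpace X]

theorem SharpSpace.continuous_mk : Continuous (SharpSpace.mk (M := M) hne hF) :=
  ((continuous_finiteTranslate hF (hne.image _)).comp continuous_subtype_val).subtype_mk _

theorem SharpSpace.compactSpace (hne : (π ⁻¹' {y₀}).Nonempty)
    (hF : (ultraAct u '' (π ⁻¹' {y₀})).Finite) :
    CompactSpace (SharpSpace M π y₀ u) := by
  have : CompactSpace M.carrier := isCompact_iff_compactSpace.1 M.isClosed_carrier.isCompact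
  exact (SharpSpace.surjective_mk hne hF).compactSpace (SharpSpace.continuous_mk hne hF)

variable [ContinuousConstSMul T X]

theorem fiberTranslate_mul (r p : Ultrafilter T) :
    fiberTranslate π y₀ u (r * p) = ultraAct r '' fiberTranslate π y₀ u p := by
  rw [fiberTranslate, fiberTranslate, image_image (ultraAct r)]
  exact image_congr fun x _ => ultraAct_mul r p x

theorem SharpSpace.smul_mk (t : T) (p : M.carrier) :
    t • SharpSpace.mk hne hF p =
      SharpSpace.mk hne hF ⟨pure t * p.1, M.mul_mem _ _ p.2⟩ := by
  refine SharpSpace.eq_mk hne hF ?_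
  change ((t • (SharpSpace.mk hne hF p : NonemptyCompacts X) : NonemptyCompacts X) : Set X) = _
  rw [hyperspace_coe_smul, SharpSpace.coe_mk, fiberTranslate_mul]
  exact image_congr fun x _ => (ultraAct_pure t x).symm

theorem SharpSpace.ultraAct_mk [CompactSpace (SharpSpace M π y₀ u)] (r : Ultrafilter T)
    (p : M.carrier) :
    ultraAct r (SharpSpace.mk hne hF p) =
      SharpSpace.mk hne hF ⟨r * p.1, M.mul_mem _ _ p.2⟩ := by
  refine (eq_ultraAct_of_continuous
    (f := fun r => SharpSpace.mk hne hF ⟨r * p.1, M.mul_mem _ _ p.2⟩) ?_ ?_ r).symm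
  · exact (SharpSpace.continuous_mk hne hF).comp
      ((Ultrafilter.continuous_mul_left p.1).subtype_mk _)
  · exact fun t => (SharpSpace.smul_mk hne hF t p).symm

theorem SharpSpace.isMinimal (hne : (π ⁻¹' {y₀}).Nonempty)
    (hF : (ultraAct u '' (π ⁻¹' {y₀})).Finite) :
    MulAction.IsMinimal T (SharpSpace M π y₀ u) := by
  have := SharpSpace.compactSpace (M := M) hne hF
  refine ⟨fun A B => ?_⟩
  obtain ⟨p, rfl⟩ := SharpSpace.surjective_mk hne hF A
  obtain ⟨q, rfl⟩ := SharpSpace.surjective_mk hne hF B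
  obtain ⟨r, hr⟩ := M.exists_mul_eq p.2 q.2
  rw [closure_orbit_eq_range_ultraAct]
  refine ⟨r, (SharpSpace.ultraAct_mk hne hF r p).trans ?_⟩
  congr 1
  exact Subtype.ext hr

end

section

variable [CompactSpace X] [ContinuousConstSMul T X] [MetricSpace Y] [MulAction T Y]

theorem exists_mem_fiberTranslate [MulAction.IsMinimal T X] (hπ : IsFactorMap T π)
    (M : MinimalLeftIdeal T) (y₀ : Y) (u : Ultrafilter T) (x : X) :
    ∃ p ∈ M.carrier, x ∈ fiberTranslate π y₀ u p := by
  obtain ⟨z, hz⟩ := hπ.surjective y₀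
  obtain ⟨p, hp, hpx⟩ := M.exists_ultraAct_eq (ultraAct u z) x
  exact ⟨p, hp, _, ⟨z, hz, rfl⟩, hpx⟩

variable [CompactSpace Y]

theorem mem_image_ultraAct_fiber (hπ : IsFactorMap T π) (huu : u * u = u)
    (huy : ultraAct u y₀ = y₀) {x : X} :
    x ∈ ultraAct u '' (π ⁻¹' {y₀}) ↔ ultraAct u x = x ∧ π x = y₀ := by
  constructor
  · rintro ⟨z, hz, rfl⟩
    rw [← ultraAct_mul, huu, map_ultraAct hπ.continuous hπ.map_smul, show π z = y₀ from hz, huy]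
    exact ⟨rfl, rfl⟩
  · rintro ⟨h, hx⟩
    exact ⟨x, hx, h⟩

theorem map_eq_of_mem_fiberTranslate (hπ : IsFactorMap T π) (huu : u * u = u)
    (huy : ultraAct u y₀ = y₀) {p : Ultrafilter T} {x : X} (hx : x ∈ fiberTranslate π y₀ u p) :
    π x = ultraAct p y₀ := by
  obtain ⟨a, ha, rfl⟩ := hx
  rw [map_ultraAct hπ.continuous hπ.map_smul, ((mem_image_ultraAct_fiber hπ huu huy).1 ha).2]

theorem finite_image_ultraAct_fiber (hπ : IsFactorMap T π) (hap : IsAlmostProximalExtension T π)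
    (hu : u ∈ M.carrier) (huu : u * u = u) (huy : ultraAct u y₀ = y₀) :
    (ultraAct u '' (π ⁻¹' {y₀})).Finite := by
  obtain ⟨N, hN⟩ := hap y₀
  refine finite_of_encard_le_coe (hN _ (fun x hx => ?_) (M.isAlmostPeriodicSet hu fun x hx => ?_))
  · exact ((mem_image_ultraAct_fiber hπ huu huy).1 hx).2
  · exact ((mem_image_ultraAct_fiber hπ huu huy).1 hx).1

/-- If `p a = q b` and `c` is another point of `F`, the automorphism `χ` given by regularity
satisfies `χ a = c` exactly, as both are `u`-fixed. Hence `p c = χ (p a) = χ (q b) = q (χ b)`. -/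
theorem fiberTranslate_subset_of_mem (hπ : IsFactorMap T π) (hreg : IsRegularExtension T π)
    (hu : u ∈ M.carrier) (huu : u * u = u) (huy : ultraAct u y₀ = y₀) {p q : Ultrafilter T}
    {x : X} (hp : x ∈ fiberTranslate π y₀ u p) (hq : x ∈ fiberTranslate π y₀ u q) :
    fiberTranslate π y₀ u p ⊆ fiberTranslate π y₀ u q := by
  obtain ⟨a, ha, rfl⟩ := hp
  obtain ⟨b, hb, hab⟩ := hq
  rintro _ ⟨c, hc, rfl⟩
  have ha' := (mem_image_ultraAct_fiber hπ huu huy).1 ha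
  have hb' := (mem_image_ultraAct_fiber hπ huu huy).1 hb
  have hc' := (mem_image_ultraAct_fiber hπ huu huy).1 hc
  obtain ⟨χ, hχ, hχπ, hprox⟩ := hreg a c (ha'.2.trans hc'.2.symm)
  have hχu : ∀ (r : Ultrafilter T) (z : X), χ (ultraAct r z) = ultraAct r (χ z) :=
    map_ultraAct χ.continuous hχ
  have hχa : χ a = c :=
    M.eq_of_isProximalPair hu (by rw [← hχu, ha'.1]) hc'.1 hprox
  refine ⟨χ b, (mem_image_ultraAct_fiber hπ huu huy).2 ⟨by rw [← hχu, hb'.1], ?_⟩, ?_⟩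
  · rw [hχπ, hb'.2]
  · rw [← hχu, hab, hχu, hχa]

theorem fiberTranslate_eq_of_mem (hπ : IsFactorMap T π) (hreg : IsRegularExtension T π)
    (hu : u ∈ M.carrier) (huu : u * u = u) (huy : ultraAct u y₀ = y₀) {p q : Ultrafilter T}
    {x : X} (hp : x ∈ fiberTranslate π y₀ u p) (hq : x ∈ fiberTranslate π y₀ u q) :
    fiberTranslate π y₀ u p = fiberTranslate π y₀ u q :=
  Subset.antisymm (fiberTranslate_subset_of_mem hπ hreg hu huu huy hp hq)
    (fiberTranslate_subset_of_mem hπ hreg hu huu huy hq hp)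

/-- A member `g` of the group `u M` which fixes `y₀` permutes `u π⁻¹(y₀)`. -/
theorem fiberTranslate_idempotent_mul [ContinuousConstSMul T Y] (hπ : IsFactorMap T π)
    (hreg : IsRegularExtension T π) (hu : u ∈ M.carrier) (huu : u * u = u) (huy : ultraAct u y₀ = y₀) {p : Ultrafilter T}
    (hp : ultraAct p y₀ = y₀) :
    fiberTranslate π y₀ u (u * p) = fiberTranslate π y₀ u u := by
  obtain ⟨x, hx⟩ := fiberTranslate_nonempty (y₀ := y₀) (u := u) hπ.surjective (u * p)
  refine fiberTranslate_eq_of_mem hπ hreg hu huu huy hx ?_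
  have h1 : π x = y₀ := by
    rw [map_eq_of_mem_fiberTranslate hπ huu huy hx, ultraAct_mul, hp, huy]
  have h2 : ultraAct u x = x := by
    obtain ⟨a, -, rfl⟩ := hx
    rw [← ultraAct_mul, ← ultrafilter_mul_assoc, huu]
  exact ⟨x, (mem_image_ultraAct_fiber hπ huu huy).2 ⟨h2, h1⟩, h2⟩

theorem isPartition_fiberTranslate [MulAction.IsMinimal T X] (hπ : IsFactorMap T π)
    (hreg : IsRegularExtension T π) (hu : u ∈ M.carrier) (huu : u * u = u)
    (huy : ultraAct u y₀ = y₀) :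
    Setoid.IsPartition {B : Set X | ∃ p ∈ M.carrier, B = fiberTranslate π y₀ u p} := by
  constructor
  · rintro ⟨p, -, h⟩
    exact (fiberTranslate_nonempty hπ.surjective p).ne_empty h.symm
  · intro x
    obtain ⟨p, hp, hx⟩ := exists_mem_fiberTranslate hπ M y₀ u x
    refine ⟨_, ⟨⟨p, hp, rfl⟩, hx⟩, ?_⟩
    rintro _ ⟨⟨q, -, rfl⟩, hxq⟩
    exact fiberTranslate_eq_of_mem hπ hreg hu huu huy hxq hx

end

end Sharp

/-! ### The factorisation of `π` -/

theorem mainTheorem9 {T X Y : Type*} [Group T] [Countable T] [Infinite T]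
    [MetricSpace X] [CompactSpace X] [MulAction T X] [ContinuousConstSMul T X]
    [MulAction.IsMinimal T X]
    [MetricSpace Y] [CompactSpace Y] [MulAction T Y] [ContinuousConstSMul T Y]
    [MulAction.IsMinimal T Y]
    (π : X → Y) (hπ : IsFactorMap T π)
    (hreg : IsRegularExtension T π) (hap : IsAlmostProximalExtension T π) :
    Nonempty (MinimalLeftIdeal T) ∧
    ∀ (M : MinimalLeftIdeal T) (y₀ : Y),
      (∃ u ∈ M.carrier, u * u = u ∧ ultraAct u y₀ = y₀) ∧
      ∀ u ∈ M.carrier, u * u = u → ultraAct u y₀ = y₀ →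
        Setoid.IsPartition {B : Set X | ∃ p ∈ M.carrier, B = fiberTranslate π y₀ u p} ∧
        CompactSpace (SharpSpace M π y₀ u) ∧
        MulAction.IsMinimal T (SharpSpace M π y₀ u) ∧
        ∃ (πs : X → SharpSpace M π y₀ u) (τs : SharpSpace M π y₀ u → Y),
          IsFactorMap T πs ∧ IsFactorMap T τs ∧ τs ∘ πs = π ∧
          (∀ p ∈ M.carrier, ∀ x ∈ fiberTranslate π y₀ u p,
            ((πs x : NonemptyCompacts X) : Set X) = fiberTranslate π y₀ u p) ∧
          (∀ p ∈ M.carrier, ∀ A : SharpSpace M π y₀ u,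
            ((A : NonemptyCompacts X) : Set X) = fiberTranslate π y₀ u p → τs A = ultraAct p y₀) ∧
          IsFiniteToOne πs ∧ IsEquicontinuousExtension T πs ∧
          IsProximalExtension T τs ∧
          (IsAlmostFiniteToOne π ↔ IsAlmostOneToOne τs) := by
  refine ⟨nonempty_minimalLeftIdeal T, fun M y₀ => ⟨M.exists_idempotent y₀, ?_⟩⟩
  intro u hu huu huy
  have hne : (π ⁻¹' {y₀}).Nonempty := hπ.surjective y₀
  have hF := finite_image_ultraAct_fiber hπ hap hu huu huy
  have hcM : CompactSpace M.carrier := isCompact_iff_compactSpace.1 M.isClosed_carrier.isCompact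
  have hcS : CompactSpace (SharpSpace M π y₀ u) := SharpSpace.compactSpace hne hF
  have hmS : MulAction.IsMinimal T (SharpSpace M π y₀ u) := SharpSpace.isMinimal hne hF
  refine ⟨isPartition_fiberTranslate hπ hreg hu huu huy, hcS, hmS, ?_⟩
  choose P hP hxP using exists_mem_fiberTranslate hπ M y₀ u
  let πs : X → SharpSpace M π y₀ u := fun x => SharpSpace.mk hne hF ⟨P x, hP x⟩
  -- The chosen point is immaterial: `π` is constant on each translate.
  let τs : SharpSpace M π y₀ u → Y := fun A => π A.1.nonempty.some
  have hπs : ∀ (p : M.carrier) (x : X), x ∈ fiberTranslate π y₀ u p →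
      πs x = SharpSpace.mk hne hF p := fun p x hx =>
    SharpSpace.eq_mk hne hF (fiberTranslate_eq_of_mem hπ hreg hu huu huy (hxP x) hx)
  have hmem : ∀ x, x ∈ ((πs x : NonemptyCompacts X) : Set X) := hxP
  have hτs : ∀ p : M.carrier, τs (SharpSpace.mk hne hF p) = ultraAct p.1 y₀ := fun p =>
    map_eq_of_mem_fiberTranslate hπ huu huy (SharpSpace.mk hne hF p).1.nonempty.some_mem
  have hcomp : τs ∘ πs = π := funext fun x =>
    (hτs _).trans (map_eq_of_mem_fiberTranslate hπ huu huy (hxP x)).symm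
  have hπf : IsFactorMap T πs := by
    obtain ⟨z, hz⟩ := hne.image (ultraAct u)
    refine ⟨?_, fun A => ?_, fun t x => ?_⟩
    · have hc : Continuous fun p : M.carrier => ultraAct p.1 z :=
        (continuous_ultraAct z).comp continuous_subtype_val
      have hs : Function.Surjective fun p : M.carrier => ultraAct p.1 z := fun x => by
        obtain ⟨p, hp, h⟩ := M.exists_ultraAct_eq z x
        exact ⟨⟨p, hp⟩, h⟩
      -- `X` is a topological quotient of `M` via `p ↦ p z`, so continuity can be tested on `M`.
      refine (hc.isClosedMap.isQuotientMap hc hs).continuous_iff.2 ?_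
      have : πs ∘ (fun p : M.carrier => ultraAct p.1 z) = SharpSpace.mk hne hF :=
        funext fun p => hπs p _ ⟨z, hz, rfl⟩
      rw [this]
      exact SharpSpace.continuous_mk hne hF
    · obtain ⟨p, rfl⟩ := SharpSpace.surjective_mk hne hF A
      exact ⟨ultraAct p.1 z, hπs p _ ⟨z, hz, rfl⟩⟩
    · rw [show t • πs x = _ from SharpSpace.smul_mk hne hF t ⟨P x, hP x⟩]
      refine hπs ⟨pure t * P x, M.mul_mem _ _ (hP x)⟩ _ ?_
      change t • x ∈ fiberTranslate π y₀ u (pure t * P x)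
      rw [fiberTranslate_mul, ← ultraAct_pure]
      exact mem_image_of_mem _ (hxP x)
  have hτf : IsFactorMap T τs := by
    refine ⟨?_, fun y => ?_, fun t A => ?_⟩
    · refine ((SharpSpace.continuous_mk hne hF).isClosedMap.isQuotientMap
        (SharpSpace.continuous_mk hne hF) (SharpSpace.surjective_mk hne hF)).continuous_iff.2 ?_
      rw [show τs ∘ SharpSpace.mk hne hF = fun p : M.carrier => ultraAct p.1 y₀ from funext hτs]
      exact (continuous_ultraAct y₀).comp continuous_subtype_val
    · obtain ⟨x, rfl⟩ := hπ.surjective y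
      exact ⟨πs x, congrFun hcomp x⟩
    · obtain ⟨p, rfl⟩ := SharpSpace.surjective_mk hne hF A
      rw [SharpSpace.smul_mk, hτs, hτs, ultraAct_pure_mul]
  have hfix : ∀ x ∈ ultraAct u '' (π ⁻¹' {y₀}), ultraAct u x = x := fun x hx =>
    ((mem_image_ultraAct_fiber hπ huu huy).1 hx).1
  have hfin : IsFiniteToOne πs := by
    intro A
    obtain ⟨p, rfl⟩ := SharpSpace.surjective_mk hne hF A
    refine (hF.image (ultraAct p.1)).subset fun x hx => ?_
    have := hmem x
    rwa [show πs x = _ from hx] at this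
  have hprox : IsProximalExtension T τs := by
    intro A B hAB
    obtain ⟨p, rfl⟩ := SharpSpace.surjective_mk hne hF A
    obtain ⟨q, rfl⟩ := SharpSpace.surjective_mk hne hF B
    rw [hτs, hτs] at hAB
    obtain ⟨r, -, hr⟩ := M.exists_ultraAct_eq (ultraAct p.1 y₀) y₀
    -- As `r` returns the common image to `y₀`, both `r p` and `r q` fix `y₀`; after the factor `u`
    -- they carry `F` onto itself.
    refine isProximalPair_of_ultraAct_eq (p := u * r) ?_
    rw [SharpSpace.ultraAct_mk, SharpSpace.ultraAct_mk]
    refine SharpSpace.eq_mk hne hF ?_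
    rw [SharpSpace.coe_mk]
    simp only [ultrafilter_mul_assoc]
    rw [fiberTranslate_idempotent_mul hπ hreg hu huu huy (by rw [ultraAct_mul, hr]),
      fiberTranslate_idempotent_mul hπ hreg hu huu huy (by rw [ultraAct_mul, ← hAB, hr])]
  refine ⟨πs, τs, hπf, hτf, hcomp, ?_, ?_, hfin, ?_, hprox, ?_, ?_⟩
  · intro p hp x hx
    rw [hπs ⟨p, hp⟩ x hx, SharpSpace.coe_mk]
  · intro p hp A hA
    rw [SharpSpace.eq_mk (p := ⟨p, hp⟩) hne hF hA, hτs]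
  · obtain ⟨δ, hδ, hsep⟩ := exists_separation_of_translates M hu hF hfix
    refine fun ε hε => ⟨δ, hδ, fun x₁ x₂ hx hd t => ?_⟩
    obtain ⟨a, ha, h₁⟩ := hxP x₁
    obtain ⟨b, hb, h₂⟩ : x₂ ∈ fiberTranslate π y₀ u (P x₁) := by
      have := hmem x₂
      rwa [← hx] at this
    -- Points of one translate closer than `δ` are equal, so equicontinuity is trivial.
    have hab : a = b := hsep _ (hP x₁) a ha b hb (by rwa [h₁, h₂])
    have hxx : x₁ = x₂ := by rw [← h₁, ← h₂, hab]
    rw [hxx, dist_self]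
    exact hε
  · rintro ⟨y, hy⟩
    refine hprox.isAlmostOneToOne hτf ⟨y, (hy.image πs).subset fun A hA => ?_⟩
    obtain ⟨x, rfl⟩ := hπf.surjective A
    exact ⟨x, (congrFun hcomp x).symm.trans hA, rfl⟩
  · rintro ⟨Z, -, hZ, hone⟩
    have : Nonempty (SharpSpace M π y₀ u) := ⟨πs hne.some⟩
    obtain ⟨A, hA⟩ := hZ.nonempty
    refine ⟨τs A, (hfin A).subset fun x hx => ?_⟩
    have hx' : πs x ∈ τs ⁻¹' {τs A} := (congrFun hcomp x).trans hx
    rwa [hone A hA] at hx'
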